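/- **Setting.** Let $1\le M'\le N$. There are $N$ secondary users (SUs) and $M'$ idle channels; the random bid $a_{ij,k}\in\mathbb R$ is the worth to SU $i$ of channel $j$ while channel $k$ is jammed. An *allocation* $h$ is an injective map from the channels to the SUs; its *elements* are the pairs $(h(j),j)$, and its vector is $\boldsymbol h=\big(\sum_{j} a_{h(j)j,k}\big)_{k=1}^{M'}\in\mathbb R^{M'}$. *Original game.* The coordinator chooses an allocation $h$, the jammer a channel $k$, and the jammer pays the coordinator $\boldsymbol h_k$; the payoff matrix $\boldsymbol U$ has $\frac{N!}{(N-M')!}$ rows and $M'$ columns. *PC-game.* Let $\boldsymbol p_2^*$ be an optimal (minimax) mixed strategy of the jammer in the original game and let $a'_{ij}=\sum_k p^*_{2,k}\,a_{ij,k}$. The coordinator chooses a profile $(l_1,\dots,l_N)\in\{1,\dots,M'\}^N$ of first preferences. In the first auction SU $i$ bids $a'_{il_i}$, for channel $l_i$ only, and the channels that receive a bid are allocated so as to maximize the sum of the accepted bids; in the second auction the remaining channels are allocated to the remaining SUs, at most one to each, so as to maximize the sum of the accepted bids $a'_{ij}$. Ties in either auction are broken by an arbitrary, possibly random, rule. The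 jammer chooses a channel $k$ and pays the coordinator the (expected) $k$-th entry of the vector of the resulting allocation; this payoff matrix has $M'^N$ rows and $M'$ columns. **Assumption (generic bids).** For all allocations $h_1,\dots,h_{M'},h_{M'+1}$ such that each of $h_1,\dots,h_{M'}$ has an element that is not an element of any other of the $M'+1$ allocations, the probability that there are real numbers $\lambda_1,\dots,\lambda_{M'}$ with $$\sum_{i=1}^{M'}\lambda_i\boldsymbol h_i=\boldsymbol h_{M'+1},\qquad \sum_{i=1}^{M'}\lambda_i=1$$ is zero. **Proposition 2.** Under this assumption, with probability one, for every optimal strategy $\boldsymbol p_2^*$ of the jammer and every tie-breaking rule, the PC-game and the original game both have a value in mixed strategies ($\max_{\boldsymbol p_1}\min_{\boldsymbol p_2}=\min_{\boldsymbol p_2}\max_{\boldsymbol p_1}$), and the two values are equal. -/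

import Mathlib

namespace AntiJamming

/-! ### Finite zero-sum games -/

/-- The expected payoff `pᵀ U q` of the row player (maximizer). -/
def payoff {R C : Type} [Fintype R] [Fintype C] (U : Matrix R C ℝ) (p : R → ℝ) (q : C → ℝ) : ℝ :=
  ∑ r, ∑ c, p r * U r c * q c

/-- `v` is the value of the game `U`, that is
`max_p min_q pᵀ U q = min_q max_p pᵀ U q = v` over mixed strategies: the row player has a mixed
strategy securing at least `v`, the column player has one conceding at most `v`. -/
def IsGameValue {R C : Type} [Fintype R] [Fintype C] (U : Matrix R C ℝ) (v : ℝ) : Prop :=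
  (∃ p ∈ stdSimplex ℝ R, ∀ q ∈ stdSimplex ℝ C, v ≤ payoff U p q) ∧
    (∃ q ∈ stdSimplex ℝ C, ∀ p ∈ stdSimplex ℝ R, payoff U p q ≤ v)

/-- `q` is an optimal (minimax) mixed strategy of the column player:
it attains `min_q max_p pᵀ U q`. -/
def IsMinimaxStrategy {R C : Type} [Fintype R] [Fintype C] (U : Matrix R C ℝ) (q : C → ℝ) : Prop :=
  q ∈ stdSimplex ℝ C ∧ ∀ q' ∈ stdSimplex ℝ C,
    (⨆ p : stdSimplex ℝ R, payoff U p q) ≤ ⨆ p : stdSimplex ℝ R, payoff U p q'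

/-! ### Allocations of the idle channels

There are `N` secondary users and `M` idle channels. The bid `a i j k` is the worth to user `i`
of channel `j` while channel `k` is jammed. -/

/-- An allocation gives every idle channel to exactly one user and at most one channel to every
user: it is an injective map from channels to users. -/
abbrev Allocation (N M : ℕ) : Type := Fin M ↪ Fin N

/-- The elements of an allocation: its pairs (user, channel). -/
def elements {N M : ℕ} (h : Allocation N M) : Finset (Fin N × Fin M) :=
  Finset.univ.image fun j => (h j, j)

/-- The vector of an allocation: its total worth, for each choice of the jammed channel. -/
def allocVec {N M : ℕ} (a : Fin N → Fin M → Fin M → ℝ) (h : Allocation N M) : Fin M → ℝ :=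
  fun k => ∑ j, a (h j) j k

/-- The payoff matrix of the original game: the coordinator chooses an allocation, the jammer
chooses an idle channel. -/
def originalGame {N M : ℕ} (a : Fin N → Fin M → Fin M → ℝ) : Matrix (Allocation N M) (Fin M) ℝ :=
  Matrix.of fun h k => allocVec a h k

/-! ### The two-level auction -/

/-- The expected bids when the jammer plays the mixed strategy `q`. -/
def expectedBid {N M : ℕ} (a : Fin N → Fin M → Fin M → ℝ) (q : Fin M → ℝ) (e : Fin N × Fin M) : ℝ :=
  ∑ k, q k * a e.1 e.2 k

/-- `z` (the set of the pairs with `z_{ij} = 1`) assigns each channel of `C` to exactly one user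
and no other channel, gives at most one channel to each user, and uses only pairs from `E`. -/
def IsAssignment {N M : ℕ} (E : Finset (Fin N × Fin M)) (C : Finset (Fin M))
    (z : Finset (Fin N × Fin M)) : Prop :=
  z ⊆ E ∧ (∀ e ∈ z, e.2 ∈ C) ∧ (∀ j ∈ C, ∃! i, (i, j) ∈ z) ∧
    ∀ i j j', (i, j) ∈ z → (i, j') ∈ z → j = j'

/-- `z` solves the auction of the channels `C` with admissible pairs `E` and bids `w`: it is an
assignment that maximizes the sum of the accepted bids. -/
def IsAuctionSolution {N M : ℕ} (w : Fin N × Fin M → ℝ) (E : Finset (Fin N × Fin M))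
    (C : Finset (Fin M)) (z : Finset (Fin N × Fin M)) : Prop :=
  IsAssignment E C z ∧ ∀ z', IsAssignment E C z' → ∑ e ∈ z', w e ≤ ∑ e ∈ z, w e

/-- `h` is a possible outcome of the two-level auction with first preferences `l`. In the first
auction every user bids only for its first preference, and the channels on which there is a bid are
sold; in the second auction the remaining channels are sold to the remaining users. -/
def IsOutcome {N M : ℕ} (w : Fin N × Fin M → ℝ) (l : Fin N → Fin M) (h : Allocation N M) : Prop :=
  ∃ z₁ z₂ : Finset (Fin N × Fin M),
    IsAuctionSolution w (Finset.univ.image fun i => (i, l i)) (Finset.univ.image l) z₁ ∧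
    IsAuctionSolution w ((z₁.image Prod.fst)ᶜ ×ˢ (z₁.image Prod.snd)ᶜ) (z₁.image Prod.snd)ᶜ z₂ ∧
    elements h = z₁ ∪ z₂

/-- A random tie-breaking rule: to every profile `l` of first preferences it assigns a probability
distribution carried by the possible outcomes of the two-level auction. -/
def IsTieBreaking {N M : ℕ} (w : Fin N × Fin M → ℝ)
    (τ : (Fin N → Fin M) → Allocation N M → ℝ) : Prop :=
  ∀ l, τ l ∈ stdSimplex ℝ (Allocation N M) ∧ ∀ h, τ l h ≠ 0 → IsOutcome w l h

/-- The payoff matrix of the two-level auction game: the coordinator chooses the profile of first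
preferences, the jammer chooses an idle channel, and the payoff is the expected worth of the
allocation that results. -/
noncomputable def pcGame {N M : ℕ} (a : Fin N → Fin M → Fin M → ℝ)
    (τ : (Fin N → Fin M) → Allocation N M → ℝ) : Matrix (Fin N → Fin M) (Fin M) ℝ :=
  Matrix.of fun l k => ∑ h, τ l h * allocVec a h k

/-! ### Generic bids -/

/-- Each of the allocations `h 0, …, h (M-1)` has an element that occurs neither in `h₀` nor in
another `h i'`. -/
def HavePrivateElements {N M : ℕ} (h₀ : Allocation N M) (h : Fin M → Allocation N M) : Prop :=
  ∀ i, ∃ e ∈ elements (h i), e ∉ elements h₀ ∧ ∀ i', i' ≠ i → e ∉ elements (h i')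

/-- The vector of `h₀` is an affine combination of the vectors of `h 0, …, h (M-1)`. -/
def AffinelyRelated {N M : ℕ} (a : Fin N → Fin M → Fin M → ℝ) (h₀ : Allocation N M)
    (h : Fin M → Allocation N M) : Prop :=
  ∃ c : Fin M → ℝ, ∑ i, c i = 1 ∧ ∑ i, c i • allocVec a (h i) = allocVec a h₀

end AntiJamming

/-!
Let `p` be an optimal mixed strategy of the coordinator in the original game. By complementary
slackness every allocation `h` in the support of `p` maximizes the sum of the bids expected under
the optimal strategy `q` of the jammer. An idle user never outbids the owner of a channel in `h`; if
it tied with the owner of *every* channel, then giving one channel to that user would produce `M`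
allocations whose vectors lie, together with that of `h`, in the hyperplane of the `x` with
`x ⬝ᵥ q = const`. Either they affinely span this hyperplane or one of them is an affine combination
of the others, and generic bids exclude both. So every idle user is strictly outbid for some
channel, and if it bids for that channel while every owner bids for its own, then the first auction
returns `h`, whatever the tie-breaking rule. Hence the rows of the two-level auction game are
mixtures of the rows of the original game, and every row used by `p` is among them, so that both
games have the same value.
-/

namespace AntiJamming

open Finset Module
open scoped Matrix

/-! ### Equilibria of finite zero-sum games -/

section Games

theorem nonempty_of_mem_stdSimplex {ι : Type*} [Fintype ι] {x : ι → ℝ} (hx : x ∈ stdSimplex ℝ ι) :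
    Nonempty ι := by
  by_contra hι
  rw [not_nonempty_iff] at hι
  simp [stdSimplex_of_isEmpty_index] at hx

theorem eq_of_forall_le_of_le_dotProduct {ι : Type*} [Fintype ι] {p x : ι → ℝ} {v : ℝ}
    (hp : p ∈ stdSimplex ℝ ι) (hx : ∀ i, x i ≤ v) (hv : v ≤ p ⬝ᵥ x) {i : ι} (hi : p i ≠ 0) :
    x i = v := by
  by_contra hne
  have hlt : p ⬝ᵥ x < ∑ j, p j * v :=
    sum_lt_sum (fun j _ => mul_le_mul_of_nonneg_left (hx j) (hp.1 j))
      ⟨i, mem_univ i, mul_lt_mul_of_pos_left ((hx i).lt_of_ne hne) ((hp.1 i).lt_of_ne' hi)⟩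
  rw [← sum_mul, hp.2, one_mul] at hlt
  exact hlt.not_ge hv

theorem vecMul_mem_stdSimplex {m n : Type*} [Fintype m] [Fintype n] {T : Matrix m n ℝ}
    (hT : ∀ i, T i ∈ stdSimplex ℝ n) {p : m → ℝ} (hp : p ∈ stdSimplex ℝ m) :
    p ᵥ* T ∈ stdSimplex ℝ n := by
  rw [Matrix.vecMul_eq_sum]
  exact (convex_stdSimplex ℝ n).sum_mem (fun i _ => hp.1 i) hp.2 fun i _ => hT i

theorem exists_mem_stdSimplex_vecMul_eq {m n : Type*} [Fintype m] [Fintype n] [DecidableEq n]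
    {T : Matrix m n ℝ} {p : n → ℝ} (hp : p ∈ stdSimplex ℝ n)
    (hT : ∀ j, p j ≠ 0 → ∃ i, T i = Pi.single j 1) : ∃ p' ∈ stdSimplex ℝ m, p' ᵥ* T = p := by
  classical
  have hconvex : Convex ℝ (T.vecMulLinear '' stdSimplex ℝ m) :=
    (convex_stdSimplex ℝ m).linear_image _
  have hsingle : ∀ j, p j ≠ 0 → Pi.single j 1 ∈ T.vecMulLinear '' stdSimplex ℝ m := fun j hj => by
    obtain ⟨i, hi⟩ := hT j hj
    exact ⟨Pi.single i 1, single_mem_stdSimplex ℝ i, by simp [hi, Matrix.row]⟩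
  have hmem := hconvex.finsum_mem hp.1 ((finsum_eq_sum_of_fintype p).trans hp.2) hsingle
  rwa [finsum_eq_sum_of_fintype, ← pi_eq_sum_univ' p] at hmem

variable {R R' C : Type} [Fintype R] [Fintype R'] [Fintype C]

theorem payoff_eq_dotProduct (U : Matrix R C ℝ) (p : R → ℝ) (q : C → ℝ) :
    payoff U p q = p ⬝ᵥ U *ᵥ q := by
  simp only [payoff, dotProduct, Matrix.mulVec, mul_sum, mul_assoc]

theorem payoff_single_left [DecidableEq R] (U : Matrix R C ℝ) (r : R) (q : C → ℝ) :
    payoff U (Pi.single r 1) q = (U *ᵥ q) r := by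
  rw [payoff_eq_dotProduct, single_one_dotProduct]

theorem payoff_mul (T : Matrix R' R ℝ) (U : Matrix R C ℝ) (p : R' → ℝ) (q : C → ℝ) :
    payoff (T * U) p q = payoff U (p ᵥ* T) q := by
  rw [payoff_eq_dotProduct, payoff_eq_dotProduct, ← Matrix.mulVec_mulVec, Matrix.dotProduct_mulVec]

/-- `(p, q)` is an equilibrium in mixed strategies of the zero-sum game `U`. The two inequalities
`payoff U p' q ≤ payoff U p q` and `payoff U p q ≤ payoff U p q'` are packed into one, as in
`IsSaddlePointOn`. -/
structure IsEquilibrium (U : Matrix R C ℝ) (p : R → ℝ) (q : C → ℝ) : Prop where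
  left_mem : p ∈ stdSimplex ℝ R
  right_mem : q ∈ stdSimplex ℝ C
  payoff_le : ∀ p' ∈ stdSimplex ℝ R, ∀ q' ∈ stdSimplex ℝ C, payoff U p' q ≤ payoff U p q'

theorem exists_isEquilibrium [Nonempty R] [Nonempty C] (U : Matrix R C ℝ) :
    ∃ p q, IsEquilibrium U p q := by
  classical
  have hR : (stdSimplex ℝ R).Nonempty := ⟨_, single_mem_stdSimplex ℝ (Classical.arbitrary R)⟩
  have hC : (stdSimplex ℝ C).Nonempty := ⟨_, single_mem_stdSimplex ℝ (Classical.arbitrary C)⟩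
  let B : (R → ℝ) →ₗ[ℝ] (C → ℝ) →ₗ[ℝ] ℝ := Matrix.toLinearMap₂' ℝ U
  obtain ⟨q, hq, p, hp, hsaddle⟩ := Sion.exists_isSaddlePointOn (f := fun q p => B p q)
    hC (convex_stdSimplex ℝ C) (isCompact_stdSimplex ℝ C)
    (fun p _ => (B p).continuous_of_finiteDimensional.lowerSemicontinuous.lowerSemicontinuousOn _)
    (fun p _ => ((B p).convexOn (convex_stdSimplex ℝ C)).quasiconvexOn)
    (convex_stdSimplex ℝ R) hR (isCompact_stdSimplex ℝ R)
    (fun q _ =>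
      (B.flip q).continuous_of_finiteDimensional.upperSemicontinuous.upperSemicontinuousOn _)
    (fun q _ => ((B.flip q).concaveOn (convex_stdSimplex ℝ R)).quasiconcaveOn)
  refine ⟨p, q, hp, hq, fun p' hp' q' hq' => ?_⟩
  simpa only [B, Matrix.toLinearMap₂'_apply', ← payoff_eq_dotProduct] using hsaddle q' hq' p' hp'

variable {U : Matrix R C ℝ} {p : R → ℝ} {q : C → ℝ}

theorem bddAbove_range_payoff (U : Matrix R C ℝ) (q : C → ℝ) :
    BddAbove (Set.range fun p : stdSimplex ℝ R => payoff U p q) := by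
  have hcont : Continuous fun p => payoff U p q := by
    unfold payoff
    fun_prop
  have hbdd := (isCompact_stdSimplex ℝ R).bddAbove_image hcont.continuousOn
  rwa [Set.image_eq_range] at hbdd

theorem IsMinimaxStrategy.exists_isEquilibrium [Nonempty R] (hq : IsMinimaxStrategy U q) :
    ∃ p, IsEquilibrium U p q := by
  have : Nonempty C := nonempty_of_mem_stdSimplex hq.1
  obtain ⟨p₀, q₀, h₀⟩ := AntiJamming.exists_isEquilibrium U
  refine ⟨p₀, h₀.left_mem, hq.1, fun p' hp' q' hq' => ?_⟩
  have : Nonempty (stdSimplex ℝ R) := ⟨⟨p', hp'⟩⟩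
  calc payoff U p' q ≤ ⨆ p : stdSimplex ℝ R, payoff U p q :=
        le_ciSup (bddAbove_range_payoff U q) ⟨p', hp'⟩
    _ ≤ ⨆ p : stdSimplex ℝ R, payoff U p q₀ := hq.2 q₀ h₀.right_mem
    _ ≤ payoff U p₀ q' := ciSup_le fun p => h₀.payoff_le p p.2 q' hq'

theorem IsEquilibrium.isGameValue (h : IsEquilibrium U p q) : IsGameValue U (payoff U p q) :=
  ⟨⟨p, h.left_mem, h.payoff_le p h.left_mem⟩,
    ⟨q, h.right_mem, fun p' hp' => h.payoff_le p' hp' q h.right_mem⟩⟩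

theorem IsEquilibrium.mulVec_le_of_ne_zero (h : IsEquilibrium U p q) {r : R} (hr : p r ≠ 0)
    (r' : R) : (U *ᵥ q) r' ≤ (U *ᵥ q) r := by
  classical
  have hle : ∀ r', (U *ᵥ q) r' ≤ payoff U p q := fun r' => by
    rw [← payoff_single_left]
    exact h.payoff_le _ (single_mem_stdSimplex ℝ r') q h.right_mem
  rw [eq_of_forall_le_of_le_dotProduct h.left_mem hle (payoff_eq_dotProduct U p q).le hr]
  exact hle r'

theorem IsEquilibrium.isGameValue_mul [DecidableEq R] {T : Matrix R' R ℝ} (h : IsEquilibrium U p q)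
    (hT : ∀ r', T r' ∈ stdSimplex ℝ R) (hsupp : ∀ r, p r ≠ 0 → ∃ r', T r' = Pi.single r 1) :
    IsGameValue (T * U) (payoff U p q) := by
  obtain ⟨p', hp', rfl⟩ := exists_mem_stdSimplex_vecMul_eq h.left_mem hsupp
  have hmul : IsEquilibrium (T * U) p' q := ⟨hp', h.right_mem, fun p₁ hp₁ q₁ hq₁ => by
    simpa only [payoff_mul] using h.payoff_le _ (vecMul_mem_stdSimplex hT hp₁) q₁ hq₁⟩
  simpa only [payoff_mul] using hmul.isGameValue

end Games

/-! ### Affine independence -/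

theorem affineIndependent_of_notMem_affineSpan_image_compl {k V P ι : Type*} [DivisionRing k]
    [AddCommGroup V] [Module k V] [AddTorsor V P] {p : ι → P}
    (hp : ∀ i, p i ∉ affineSpan k (p '' {i}ᶜ)) : AffineIndependent k p := by
  classical
  rw [affineIndependent_def]
  by_contra! ⟨s, w, hw, hwp, i, his, hwi⟩
  let w' : ι → k := -(w i)⁻¹ • w + Pi.single i 1
  have hw' : ∑ j ∈ s, w' j = 1 := by
    simp [w', sum_add_distrib, ← mul_sum, hw, his, sum_pi_single']
  have hpi : s.affineCombination k p w' = p i := by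
    rw [← weightedVSub_vadd_affineCombination, weightedVSub_const_smul, hwp, smul_zero, zero_vadd,
      s.affineCombination_piSingle k p his]
  refine hp i (hpi ▸ affineCombination_mem_affineSpan_image hw' (fun j _ hj => ?_) p)
  obtain rfl : j = i := by simpa using hj
  simp [w', hwi]

theorem mem_affineSpan_range_of_dual_apply_eq {k V ι : Type*} [Field k] [AddCommGroup V]
    [Module k V] [FiniteDimensional k V] [Fintype ι] {f : Dual k V} (hf : f ≠ 0)
    (hι : Fintype.card ι = finrank k V) {p : ι → V} (hp : AffineIndependent k p) {x : V}
    (hx : ∀ i, f (p i) = f x) : x ∈ affineSpan k (Set.range p) := by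
  let H : AffineSubspace k V := AffineSubspace.mk' x f.ker
  have hpH : affineSpan k (Set.range p) ≤ H := by
    rw [affineSpan_le]
    rintro _ ⟨i, rfl⟩
    simp [H, AffineSubspace.mem_mk', hx]
  have hcard : Fintype.card ι = finrank k H.direction + 1 := by
    rw [AffineSubspace.direction_mk', Dual.finrank_ker_add_one_of_ne_zero hf, hι]
  rw [hp.affineSpan_eq_of_le_of_card_eq_finrank_add_one hpH hcard]
  exact AffineSubspace.self_mem_mk' x _

variable {N M : ℕ}

/-! ### Sums of accepted bids -/

section Allocations

theorem mem_elements {h : Allocation N M} {i : Fin N} {j : Fin M} :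
    (i, j) ∈ elements h ↔ h j = i := by
  simp [elements]

/-- The sum of the bids `w` accepted when the channels are sold according to `h`, written as a sum
over the channels rather than over `elements h`. -/
def totalBid (w : Fin N × Fin M → ℝ) (h : Allocation N M) : ℝ :=
  ∑ j, w (h j, j)

theorem sum_elements (w : Fin N × Fin M → ℝ) (h : Allocation N M) :
    ∑ e ∈ elements h, w e = totalBid w h :=
  sum_image fun _ _ _ _ heq => congrArg Prod.snd heq

theorem allocVec_dotProduct (a : Fin N → Fin M → Fin M → ℝ) (h : Allocation N M) (q : Fin M → ℝ) :
    allocVec a h ⬝ᵥ q = totalBid (expectedBid a q) h := by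
  simp only [dotProduct, allocVec, totalBid, expectedBid, sum_mul, mul_comm (q _)]
  exact sum_comm

theorem originalGame_mulVec (a : Fin N → Fin M → Fin M → ℝ) (q : Fin M → ℝ) :
    originalGame a *ᵥ q = totalBid (expectedBid a q) :=
  funext fun h => allocVec_dotProduct a h q

theorem totalBid_setValue_sub (w : Fin N × Fin M → ℝ) {h : Allocation N M} {i : Fin N}
    (hi : i ∉ Set.range h) (j : Fin M) :
    totalBid w (h.setValue j i) - totalBid w h = w (i, j) - w (h j, j) := by
  rw [totalBid, totalBid, ← sum_sub_distrib, Fintype.sum_eq_single j, h.setValue_eq]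
  intro j' hj'
  rw [Function.Embedding.setValue_eq_of_ne hj' fun hij => hi ⟨j', hij⟩, sub_self]

end Allocations

/-! ### Consequences of genericity -/

section GenericBids

/-- The bids `a` are generic: no affine relation holds between the vectors of allocations that the
assumption on the random bids considers. That assumption says that this has probability one. -/
def IsGeneric (a : Fin N → Fin M → Fin M → ℝ) : Prop :=
  ∀ (h₀ : Allocation N M) (h : Fin M → Allocation N M),
    HavePrivateElements h₀ h → ¬ AffinelyRelated a h₀ h

theorem affinelyRelated_of_mem_affineSpan {a : Fin N → Fin M → Fin M → ℝ} {h₀ : Allocation N M}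
    {h : Fin M → Allocation N M}
    (hmem : allocVec a h₀ ∈ affineSpan ℝ (Set.range fun i => allocVec a (h i))) :
    AffinelyRelated a h₀ h := by
  obtain ⟨c, hc, heq⟩ := eq_affineCombination_of_mem_affineSpan_of_fintype hmem
  exact ⟨c, hc, by rw [heq, univ.affineCombination_eq_linear_combination _ c hc]⟩

variable {h : Allocation N M} {i : Fin N}

theorem havePrivateElements_setValue (hi : i ∉ Set.range h) :
    HavePrivateElements h fun j => h.setValue j i := by
  intro j
  refine ⟨(i, j), ?_, ?_, fun j' hj' => ?_⟩
  · simp [mem_elements]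
  · exact fun hij => hi ⟨j, mem_elements.1 hij⟩
  · simpa [mem_elements] using hj'.symm

/- Exchanging the owners of `s` and `t` in `h` creates the private element `(h s, t)`: in every
other allocation here, channel `t` goes to `i` or stays with `h t`. -/
theorem havePrivateElements_update_setValue (hi : i ∉ Set.range h) {s t : Fin M} (hts : t ≠ s) :
    HavePrivateElements (h.setValue s i) (Function.update (fun j => h.setValue j i) s
      ((Equiv.swap s t).toEmbedding.trans h)) := by
  have hst : ∀ j, (h s, t) ∉ elements (h.setValue j i) := fun j hj => by
    rw [mem_elements] at hj
    obtain rfl | htj := eq_or_ne t j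
    · rw [h.setValue_eq] at hj
      exact hi ⟨s, hj.symm⟩
    · rw [Function.Embedding.setValue_eq_of_ne htj fun hit => hi ⟨t, hit⟩] at hj
      exact hts (h.injective hj)
  intro j
  obtain rfl | hj := eq_or_ne j s
  · refine ⟨(h j, t), ?_, hst j, fun j' hj' => ?_⟩
    · simp [mem_elements]
    · simpa [hj'] using hst j'
  · refine ⟨(i, j), ?_, ?_, fun j' hj' => ?_⟩
    · simp [mem_elements, hj]
    · simpa [mem_elements] using hj
    · obtain rfl | hj's := eq_or_ne j' s
      · rw [Function.update_self, mem_elements]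
        exact fun hij => hi ⟨_, hij⟩
      · simpa [mem_elements, hj's] using hj'.symm

variable {a : Fin N → Fin M → Fin M → ℝ}

theorem IsGeneric.affineIndependent_setValue (ha : IsGeneric a) (hi : i ∉ Set.range h) :
    AffineIndependent ℝ fun j => allocVec a (h.setValue j i) := by
  refine affineIndependent_of_notMem_affineSpan_image_compl fun s hs => ?_
  obtain ⟨-, t, hts, rfl⟩ := (affineSpan_nonempty ℝ).1 ⟨_, hs⟩
  refine ha _ _ (havePrivateElements_update_setValue hi hts)
    (affinelyRelated_of_mem_affineSpan (affineSpan_mono ℝ ?_ hs))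
  rintro _ ⟨j, hj, rfl⟩
  exact ⟨j, by simp only [Function.update_of_ne hj]⟩

theorem IsGeneric.exists_expectedBid_ne (ha : IsGeneric a) {q : Fin M → ℝ} (hq : q ≠ 0)
    (hi : i ∉ Set.range h) : ∃ j, expectedBid a q (i, j) ≠ expectedBid a q (h j, j) := by
  by_contra! htie
  have hdot : ∀ j, q ⬝ᵥ allocVec a (h.setValue j i) = q ⬝ᵥ allocVec a h := fun j => by
    rw [dotProduct_comm, allocVec_dotProduct, dotProduct_comm, allocVec_dotProduct, ← sub_eq_zero,
      totalBid_setValue_sub _ hi, htie, sub_self]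
  refine ha _ _ (havePrivateElements_setValue hi) (affinelyRelated_of_mem_affineSpan ?_)
  exact mem_affineSpan_range_of_dual_apply_eq (f := dotProductEquiv ℝ (Fin M) q) (by simpa using hq)
    (by simp) (ha.affineIndependent_setValue hi) hdot

end GenericBids

/-! ### Outcomes of the two-level auction -/

section Auction

variable {w : Fin N × Fin M → ℝ} {l : Fin N → Fin M} {h h' : Allocation N M}

theorem isAssignment_elements {E : Finset (Fin N × Fin M)} (hE : elements h ⊆ E) :
    IsAssignment E univ (elements h) := by
  refine ⟨hE, fun _ _ => mem_univ _, fun j _ => ⟨h j, mem_elements.2 rfl, fun i hi => ?_⟩,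
    fun i j j' hj hj' => ?_⟩
  · exact (mem_elements.1 hi).symm
  · exact h.injective ((mem_elements.1 hj).trans (mem_elements.1 hj').symm)

theorem IsAuctionSolution.totalBid_le {E : Finset (Fin N × Fin M)}
    (hsol : IsAuctionSolution w E univ (elements h)) (hE : elements h' ⊆ E) :
    totalBid w h' ≤ totalBid w h := by
  simpa only [sum_elements] using hsol.2 _ (isAssignment_elements hE)

theorem elements_subset_image_iff :
    elements h ⊆ univ.image (fun i => (i, l i)) ↔ Function.LeftInverse l h := by
  simp [elements, Function.LeftInverse, subset_iff]

theorem IsOutcome.isAuctionSolution (hout : IsOutcome w l h) (hl : Function.Surjective l) :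
    IsAuctionSolution w (univ.image fun i => (i, l i)) univ (elements h) := by
  obtain ⟨z₁, z₂, hsol₁, ⟨⟨-, hz₂, -⟩, -⟩, hunion⟩ := hout
  rw [image_univ_of_surjective hl] at hsol₁
  have hsold : z₁.image Prod.snd = univ := eq_univ_of_forall fun j => by
    obtain ⟨i, hi, -⟩ := hsol₁.1.2.2.1 j (mem_univ j)
    exact mem_image_of_mem Prod.snd hi
  have hempty : z₂ = ∅ := eq_empty_of_forall_notMem fun e he => by
    simpa only [hsold, compl_univ, notMem_empty] using hz₂ e he
  rwa [hunion, hempty, union_empty]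

theorem IsOutcome.eq_of_outbid (hout : IsOutcome w l h') (hl : Function.LeftInverse l h)
    (hidle : ∀ i ∉ Set.range h, w (i, l i) < w (h (l i), l i)) : h' = h := by
  have hsol := hout.isAuctionSolution hl.surjective
  have hl' : Function.LeftInverse l h' := elements_subset_image_iff.1 hsol.1.1
  have hlt : ∀ j, h' j ≠ h j → w (h' j, j) < w (h j, j) := fun j hne => by
    have hnot_owner : h' j ∉ Set.range h := by
      rintro ⟨j', hj'⟩
      obtain rfl : j' = j := by rw [← hl j', hj', hl' j]
      exact hne hj'.symm
    simpa only [hl' j] using hidle _ hnot_owner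
  have hle : ∀ j, w (h' j, j) ≤ w (h j, j) := fun j => by
    by_cases heq : h' j = h j
    · rw [heq]
    · exact (hlt j heq).le
  by_contra hne
  obtain ⟨j, hj⟩ := DFunLike.ne_iff.1 hne
  exact (hsol.totalBid_le (elements_subset_image_iff.2 hl)).not_gt
    (sum_lt_sum (fun j _ => hle j) ⟨j, mem_univ j, hlt j hj⟩)

theorem IsGeneric.exists_forall_isOutcome_eq {a : Fin N → Fin M → Fin M → ℝ} (ha : IsGeneric a)
    {q : Fin M → ℝ} (hq : q ≠ 0)
    (hmax : ∀ h', totalBid (expectedBid a q) h' ≤ totalBid (expectedBid a q) h) :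
    ∃ l, ∀ h', IsOutcome (expectedBid a q) l h' → h' = h := by
  have : Nonempty (Fin M) := (Function.ne_iff.1 hq).nonempty
  have houtbid : ∀ i ∉ Set.range h, ∃ j, expectedBid a q (i, j) < expectedBid a q (h j, j) := by
    intro i hi
    obtain ⟨j, hne⟩ := ha.exists_expectedBid_ne hq hi
    have hle : expectedBid a q (i, j) ≤ expectedBid a q (h j, j) := by
      rw [← sub_nonpos, ← totalBid_setValue_sub _ hi, sub_nonpos]
      exact hmax _
    exact ⟨j, hle.lt_of_ne hne⟩
  choose! lost hlost using houtbid
  refine ⟨Function.extend h id lost, fun h' hout => hout.eq_of_outbid (fun j => ?_) fun i hi => ?_⟩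
  · exact h.injective.extend_apply id lost j
  · rw [Function.extend_apply' id lost i hi]
    exact hlost i hi

end Auction

/-! ### Equality of the values -/

section Values

variable {a : Fin N → Fin M → Fin M → ℝ} {q : Fin M → ℝ}
  {τ : (Fin N → Fin M) → Allocation N M → ℝ}

theorem pcGame_eq_mul (a : Fin N → Fin M → Fin M → ℝ)
    (τ : (Fin N → Fin M) → Allocation N M → ℝ) : pcGame a τ = Matrix.of τ * originalGame a :=
  rfl

theorem IsTieBreaking.eq_single {w : Fin N × Fin M → ℝ} (hτ : IsTieBreaking w τ)
    {l : Fin N → Fin M} {h : Allocation N M} (hl : ∀ h', IsOutcome w l h' → h' = h) :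
    τ l = Pi.single h 1 := by
  have hzero : ∀ h', h' ≠ h → τ l h' = 0 := fun h' => not_imp_comm.1 (hl h' ∘ (hτ l).2 h')
  have hone : τ l h = 1 := by rw [← (hτ l).1.2, Fintype.sum_eq_single h hzero]
  ext h'
  obtain rfl | hne := eq_or_ne h' h
  · rw [hone, Pi.single_eq_same]
  · rw [hzero h' hne, Pi.single_eq_of_ne hne]

theorem IsTieBreaking.nonempty_allocation [Nonempty (Fin M)] {w : Fin N × Fin M → ℝ}
    (hτ : IsTieBreaking w τ) : Nonempty (Allocation N M) :=
  nonempty_of_mem_stdSimplex (hτ (Classical.arbitrary _)).1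

theorem IsGeneric.exists_isGameValue (ha : IsGeneric a)
    (hq : IsMinimaxStrategy (originalGame a) q) (hτ : IsTieBreaking (expectedBid a q) τ) :
    ∃ v, IsGameValue (originalGame a) v ∧ IsGameValue (pcGame a τ) v := by
  have : Nonempty (Fin M) := nonempty_of_mem_stdSimplex hq.1
  have : Nonempty (Allocation N M) := hτ.nonempty_allocation
  have hq₀ : q ≠ 0 := by
    rintro rfl
    simpa using hq.1.2
  obtain ⟨p, hpq⟩ := hq.exists_isEquilibrium
  refine ⟨payoff (originalGame a) p q, hpq.isGameValue, ?_⟩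
  rw [pcGame_eq_mul]
  refine hpq.isGameValue_mul (fun l => (hτ l).1) fun h hph => ?_
  have hmax : ∀ h', totalBid (expectedBid a q) h' ≤ totalBid (expectedBid a q) h := fun h' => by
    simpa only [originalGame_mulVec] using hpq.mulVec_le_of_ne_zero hph h'
  obtain ⟨l, hl⟩ := ha.exists_forall_isOutcome_eq hq₀ hmax
  exact ⟨l, hτ.eq_single hl⟩

end Values

end AntiJamming

theorem proposition2_general {Ω : Type*} [MeasurableSpace Ω] (μ : MeasureTheory.Measure Ω)
    (N M : ℕ) (a : Ω → Fin N → Fin M → Fin M → ℝ)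
    (hgen : ∀ (h₀ : AntiJamming.Allocation N M) (h : Fin M → AntiJamming.Allocation N M),
      AntiJamming.HavePrivateElements h₀ h → μ {ω | AntiJamming.AffinelyRelated (a ω) h₀ h} = 0) :
    ∀ᵐ ω ∂μ, ∀ q : Fin M → ℝ,
      AntiJamming.IsMinimaxStrategy (AntiJamming.originalGame (a ω)) q →
      ∀ τ : (Fin N → Fin M) → AntiJamming.Allocation N M → ℝ,
        AntiJamming.IsTieBreaking (AntiJamming.expectedBid (a ω) q) τ →
        ∃ v : ℝ, AntiJamming.IsGameValue (AntiJamming.originalGame (a ω)) v ∧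
          AntiJamming.IsGameValue (AntiJamming.pcGame (a ω) τ) v := by
  have hgeneric : ∀ᵐ ω ∂μ, AntiJamming.IsGeneric (a ω) := by
    simp only [AntiJamming.IsGeneric, MeasureTheory.ae_all_iff]
    exact fun h₀ h hpriv => MeasureTheory.measure_eq_zero_iff_ae_notMem.1 (hgen h₀ h hpriv)
  filter_upwards [hgeneric] with ω hω q hq τ hτ
  exact hω.exists_isGameValue hq hτ

theorem proposition2 {Ω : Type*} [MeasurableSpace Ω] (μ : MeasureTheory.Measure Ω)
    [MeasureTheory.IsProbabilityMeasure μ] (N M : ℕ) (hM : 1 ≤ M) (hMN : M ≤ N)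
    (a : Ω → Fin N → Fin M → Fin M → ℝ)
    (hgen : ∀ (h₀ : AntiJamming.Allocation N M) (h : Fin M → AntiJamming.Allocation N M),
      AntiJamming.HavePrivateElements h₀ h → μ {ω | AntiJamming.AffinelyRelated (a ω) h₀ h} = 0) :
    ∀ᵐ ω ∂μ, ∀ q : Fin M → ℝ,
      AntiJamming.IsMinimaxStrategy (AntiJamming.originalGame (a ω)) q →
      ∀ τ : (Fin N → Fin M) → AntiJamming.Allocation N M → ℝ,
        AntiJamming.IsTieBreaking (AntiJamming.expectedBid (a ω) q) τ →
        ∃ v : ℝ, AntiJamming.IsGameValue (AntiJamming.originalGame (a ω)) v ∧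
          AntiJamming.IsGameValue (AntiJamming.pcGame (a ω) τ) v :=
  proposition2_general μ N M a hgen
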